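/- Let $\mathbb D=\{z\in\mathbb C:|z|<1\}$. For $0<\alpha<1$, an analytic function $f$ on $\mathbb D$ with $f(0)=0$ and $f'(0)=1$ is called strongly starlike of order $\alpha$ if $|\arg[zf'(z)/f(z)]|<\pi\alpha/2$ for all $z\in\mathbb D$; this includes the requirement that $f(z)\neq0$ and $f'(z)\ne 0$ for $0<|z|<1$, and the quotient is given its limit value $1$ at $z=0$. Let ${}_2F_1(a,b;c;z)=\sum_{n\ge0}\frac{(a)_n(b)_n}{(c)_n\,n!}z^n$ for $|z|<1$ and $c\neq0,-1,-2,\dots$, where $(x)_0=1$ and $(x)_n=x(x+1)\cdots(x+n-1)$ for $n\ge 1$. Let $\alpha$ be a real number with $0<\alpha<1$ and let $a,b$ be complex numbers with $ab\neq0$ and $a+b\neq-1,-2,-3,\dots$. Then the function $z\,{}_2F_1(a,b;a+b+1;z)$ is strongly starlike of order $\alpha$ if (i) $|\arg(ab)|<\pi\alpha/2$ (principal argument), and (ii) for all $s\in(0,+\infty)$ and both signs $\varepsilon=\pm1$, $$2s^{2\alpha}\,\mathrm{Re}\big[e^{-\varepsilon\pi i\alpha}ab\big]+2s^{\alpha}\,\mathrm{Re}\big[e^{-\varepsilon\pi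 i\alpha/2}ab(\bar a+\bar b-2)\big]+|ab|^2-2\,\mathrm{Re}\big[ab(\bar a+\bar b-1)\big]\le\alpha(s+s^{-1})s^{\alpha}\,\mathrm{Re}\big[e^{\varepsilon\pi i(1-\alpha)/2}ab\big].$$ -/

import Mathlib

/-- `f` is strongly starlike of order `α`: it is analytic on the unit disk `𝔻`, normalized by
`f 0 = 0` and `f' 0 = 1`, and `|arg (z f'(z) / f(z))| < π α / 2` on `𝔻`.
At `z = 0` the quotient `z f'(z) / f(z)` has the removable value `1`, whose argument is `0`, so the
condition is only imposed at `z ≠ 0`. That the argument is meaningful, i.e. that the quotient is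
finite and nonzero, is part of the definition. -/
structure IsStronglyStarlikeOfOrder (α : ℝ) (f : ℂ → ℂ) : Prop where
  analytic : AnalyticOnNhd ℂ f (Metric.ball (0 : ℂ) 1)
  map_zero : f 0 = 0
  deriv_zero : deriv f 0 = 1
  ne_zero : ∀ z ∈ Metric.ball (0 : ℂ) 1, z ≠ 0 → f z ≠ 0
  deriv_ne_zero : ∀ z ∈ Metric.ball (0 : ℂ) 1, z ≠ 0 → deriv f z ≠ 0
  abs_arg_lt : ∀ z ∈ Metric.ball (0 : ℂ) 1, z ≠ 0 →
    |Complex.arg (z * deriv f z / f z)| < Real.pi * α / 2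

/-- The shifted hypergeometric function `z ↦ z ₂F₁(a, b; c; z)`. -/
noncomputable def shiftedHypergeometric (a b c : ℂ) (z : ℂ) : ℂ :=
  z * ordinaryHypergeometric a b c z

/-!
Write `F = ₂F₁(a, b; a + b + 1; ·)`, `f z = z F z` and `q = z f' / f = 1 + z F' / F`, so that
`q 0 = 1`, and suppose that `q` leaves the sector `|arg| < π α / 2` for the first time at `z₀`.
Since `Re q ≥ 0` on the disk `|z| < |z₀|`, the modulus of `z F z` increases along its radii, so `F`
does not vanish at `z₀`. The function `q ^ (1 / α)` has positive real part on that disk, and Jack's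
lemma, transported to the right half-plane by a Cayley transform, bounds its derivative at `z₀` away
from zero. As `1 / α > 1`, this is impossible if `q z₀` is the apex of the sector; otherwise
`q z₀ = (ε i s) ^ α` with `ε = ±1`, `s > 0` and
`z₀ q'(z₀) = (k α (s + s⁻¹) / 2) (ε i) q z₀` for some `k ≥ 1`.
The hypergeometric equation becomes the Riccati equation
`z q' + (q - 1) (q + a + b - 1) = a b z / (1 - z)`. Multiplying it at `z₀` by the conjugate of `a b`
and taking real parts contradicts the assumed inequality, because `Re (z / (1 - z)) > -1 / 2`.
-/

open Complex Filter Metric Set Topology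
open scoped ComplexConjugate ComplexOrder Nat

section JackLemma

theorem nonneg_of_forall_re_mul_le_re {c : ℂ} (h : ∀ u ∈ ball (0 : ℂ) 1, (c * u).re ≤ c.re) :
    0 ≤ c := by
  have hclosed : ∀ u ∈ closedBall (0 : ℂ) 1, (c * u).re ≤ c.re := by
    rw [← closure_ball (0 : ℂ) one_ne_zero]
    exact fun u hu ↦ le_on_closure h (by fun_prop) (by fun_prop) hu
  have hmem : conj c / ‖c‖ ∈ closedBall (0 : ℂ) 1 := by
    simpa using div_self_le_one ‖c‖
  have hmul : c * (conj c / ‖c‖) = (‖c‖ : ℝ) := by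
    rw [mul_div_assoc', mul_conj', sq, mul_self_div_self]
  have hnorm : ‖c‖ ≤ c.re := by simpa only [hmul, ofReal_re] using hclosed _ hmem
  exact re_eq_norm.1 (le_antisymm (re_le_norm c) hnorm)

theorem sub_mem_posTangentConeAt_insert_ball {z₀ u : ℂ} (hz₀ : z₀ ≠ 0) (hu : u ∈ ball (0 : ℂ) 1) :
    z₀ * u - z₀ ∈ posTangentConeAt (insert z₀ (ball 0 ‖z₀‖)) z₀ := by
  have hmem : z₀ * u ∈ ball (0 : ℂ) ‖z₀‖ := by
    rw [mem_ball_zero_iff, norm_mul]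
    exact mul_lt_of_lt_one_right (norm_pos_iff.2 hz₀) (mem_ball_zero_iff.1 hu)
  have hsegment : openSegment ℝ z₀ (z₀ * u) ⊆ interior (ball 0 ‖z₀‖) :=
    (convex_ball (0 : ℂ) ‖z₀‖).openSegment_closure_interior_subset_interior
      (by simp [closure_ball, hz₀]) (by rwa [isOpen_ball.interior_eq])
  exact sub_mem_posTangentConeAt_of_openSegment_subset
    (hsegment.trans (interior_subset.trans (subset_insert _ _)))

/-- The difference `‖z₀‖² ‖ω z‖² - ‖ω z₀‖² ‖z‖²` is maximal at `z₀`, so its derivative is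
nonpositive in every direction `z₀ (u - 1)` pointing into the disk. -/
theorem nonneg_conj_mul_mul_deriv_sub {ω : ℂ → ℂ} {z₀ d : ℂ} (hz₀ : z₀ ≠ 0)
    (hω : ∀ z ∈ ball (0 : ℂ) ‖z₀‖, ‖ω z‖ * ‖z₀‖ ≤ ‖ω z₀‖ * ‖z‖) (hd : HasDerivAt ω d z₀) :
    0 ≤ conj (ω z₀) * (z₀ * d) - ‖ω z₀‖ ^ 2 := by
  refine nonneg_of_forall_re_mul_le_re fun u hu ↦ ?_
  set s : Set ℂ := insert z₀ (ball 0 ‖z₀‖)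
  have hmax : IsMaxOn (fun z ↦ ‖z₀‖ ^ 2 * ‖ω z‖ ^ 2 - ‖ω z₀‖ ^ 2 * ‖z‖ ^ 2) s z₀ := by
    rintro z (rfl | hz)
    · exact le_refl (_ : ℝ)
    · have hsq := pow_le_pow_left₀ (by positivity) (hω z hz) 2
      simp only [mul_pow] at hsq
      simp only [mem_ofPred_eq]
      linarith
  have hderiv := ((hd.hasFDerivAt.restrictScalars ℝ).norm_sq.const_mul (‖z₀‖ ^ 2)).sub
    ((hasFDerivAt_id (𝕜 := ℝ) z₀).norm_sq.const_mul (‖ω z₀‖ ^ 2))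
  have hle := hmax.localize.hasFDerivWithinAt_nonpos hderiv.hasFDerivWithinAt
    (sub_mem_posTangentConeAt_insert_ball hz₀ hu)
  simp only [sub_apply, smul_apply, ContinuousLinearMap.comp_apply,
    ContinuousLinearMap.coe_restrictScalars', ContinuousLinearMap.toSpanSingleton_apply,
    ContinuousLinearMap.id_apply, innerSL_apply_apply, id_eq, Complex.inner, smul_eq_mul,
    nsmul_eq_mul, Nat.cast_ofNat] at hle
  have hid : (z₀ * u - z₀) * conj z₀ = (‖z₀‖ ^ 2 : ℝ) * (u - 1) := by
    rw [ofReal_pow, ← mul_conj']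
    ring
  have hcomp : (z₀ * u - z₀) * d * conj (ω z₀) = conj (ω z₀) * (z₀ * d) * (u - 1) := by ring
  rw [hid, hcomp, re_ofReal_mul] at hle
  have hscaled : ‖z₀‖ ^ 2 * ((conj (ω z₀) * (z₀ * d) - (‖ω z₀‖ ^ 2 : ℝ)) * (u - 1)).re ≤ 0 := by
    rw [sub_mul, sub_re, re_ofReal_mul]
    linarith
  rw [mul_sub_one, sub_re] at hscaled
  simpa using nonpos_of_mul_nonpos_right hscaled (by positivity)

/-- **Jack's lemma**, reduced to `nonneg_conj_mul_mul_deriv_sub` by the Schwarz lemma. -/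
theorem exists_one_le_mul_deriv_eq_of_norm_le {ω : ℂ → ℂ} {z₀ d : ℂ}
    (hω : DifferentiableOn ℂ ω (ball 0 ‖z₀‖)) (h0 : ω 0 = 0)
    (hmax : ∀ z ∈ ball (0 : ℂ) ‖z₀‖, ‖ω z‖ ≤ ‖ω z₀‖) (hne : ω z₀ ≠ 0) (hd : HasDerivAt ω d z₀) :
    ∃ k : ℝ, 1 ≤ k ∧ z₀ * d = k * ω z₀ := by
  have hz₀ : z₀ ≠ 0 := by
    rintro rfl
    exact hne h0
  have hschwarz : ∀ z ∈ ball (0 : ℂ) ‖z₀‖, ‖ω z‖ * ‖z₀‖ ≤ ‖ω z₀‖ * ‖z‖ := by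
    intro z hz
    have hdist := dist_le_div_mul_dist_of_mapsTo_ball (R₂ := ‖ω z₀‖) hω
      (fun w hw ↦ by simpa [h0] using hmax w hw) hz
    rwa [h0, dist_zero_right, dist_zero_right, div_mul_eq_mul_div,
      le_div_iff₀ (norm_pos_iff.2 hz₀)] at hdist
  obtain ⟨x, hx, hxe⟩ : ∃ x : ℝ, 0 ≤ x ∧ (x : ℂ) = conj (ω z₀) * (z₀ * d) - ‖ω z₀‖ ^ 2 :=
    RCLike.nonneg_iff_exists_ofReal.1 (nonneg_conj_mul_mul_deriv_sub hz₀ hschwarz hd)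
  have hpos : 0 < ‖ω z₀‖ ^ 2 := by positivity
  refine ⟨1 + x / ‖ω z₀‖ ^ 2, by linarith [div_nonneg hx hpos.le], ?_⟩
  have hconj : conj (ω z₀) ≠ 0 := by simpa using hne
  have hω2 : ω z₀ * conj (ω z₀) = (‖ω z₀‖ : ℂ) ^ 2 := mul_conj' _
  apply mul_left_cancel₀ hconj
  push_cast
  rw [← hω2]
  rw [← hω2] at hxe
  field_simp
  linear_combination -hxe

end JackLemma

section BoundaryDerivative

theorem norm_add_conj_sq (w a : ℂ) : ‖w + conj a‖ ^ 2 = ‖w - a‖ ^ 2 + 4 * w.re * a.re := by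
  simp only [← normSq_eq_norm_sq, normSq_apply, add_re, add_im, sub_re, sub_im, conj_re, conj_im]
  ring

/-- Jack's lemma for the Cayley transform `(H - H 0) / (H + conj (H 0))`. -/
theorem exists_mul_deriv_eq_of_re_pos {H : ℂ → ℂ} {z₀ d : ℂ}
    (hH : DifferentiableOn ℂ H (ball 0 ‖z₀‖)) (hpos : ∀ z ∈ ball (0 : ℂ) ‖z₀‖, 0 < (H z).re)
    (hz₀ : z₀ ≠ 0) (hd : HasDerivAt H d z₀) (hre : (H z₀).re = 0) :
    ∃ k : ℝ, 1 ≤ k ∧ 2 * (H 0).re * (z₀ * d) = -(k * ‖H z₀ - H 0‖ ^ 2) := by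
  have hH0 : 0 < (H 0).re := hpos 0 (by simpa)
  have hden : ∀ w : ℂ, 0 ≤ w.re → w + conj (H 0) ≠ 0 := fun w hw h ↦ by
    have := congrArg re h
    simp only [add_re, conj_re, zero_re] at this
    linarith
  have hnorm_le : ∀ w : ℂ, 0 ≤ w.re → ‖(w - H 0) / (w + conj (H 0))‖ ≤ 1 := fun w hw ↦ by
    rw [norm_div]
    refine div_le_one_of_le₀ ?_ (norm_nonneg _)
    rw [← sq_le_sq₀ (norm_nonneg _) (norm_nonneg _), norm_add_conj_sq]
    have : 0 ≤ w.re * (H 0).re := by positivity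
    linarith
  have hne : H z₀ + conj (H 0) ≠ 0 := hden _ hre.ge
  have hnorm_eq : ‖H z₀ - H 0‖ = ‖H z₀ + conj (H 0)‖ := by
    rw [← sq_eq_sq₀ (norm_nonneg _) (norm_nonneg _), norm_add_conj_sq, hre]
    ring
  have hnorm_one : ‖(H z₀ - H 0) / (H z₀ + conj (H 0))‖ = 1 := by
    rw [norm_div, hnorm_eq, div_self (norm_ne_zero_iff.2 hne)]
  obtain ⟨k, hk, hjack⟩ := exists_one_le_mul_deriv_eq_of_norm_le
    (ω := fun z ↦ (H z - H 0) / (H z + conj (H 0)))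
    ((hH.sub_const _).div (hH.add_const _) fun z hz ↦ hden _ (hpos z hz).le)
    (by simp) (fun z hz ↦ hnorm_one ▸ hnorm_le _ (hpos z hz).le)
    (norm_ne_zero_iff.1 (hnorm_one ▸ one_ne_zero)) ((hd.sub_const _).div (hd.add_const _) hne)
  refine ⟨k, hk, ?_⟩
  have hconj : conj (H z₀ - H 0) = -(H z₀ + conj (H 0)) := by
    apply Complex.ext <;> simp [hre, add_comm]
  have hnorm : (‖H z₀ - H 0‖ : ℂ) ^ 2 = -((H z₀ - H 0) * (H z₀ + conj (H 0))) := by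
    rw [← mul_conj', hconj, mul_neg]
  have hadd : H 0 + conj (H 0) = 2 * (H 0).re := by rw [add_conj]; push_cast; rfl
  rw [hnorm, ← hadd]
  field_simp at hjack
  linear_combination hjack

end BoundaryDerivative

section Sector

/-- The open sector of half-angle `θ` about the positive real axis. The apex is excluded
explicitly because `arg 0 = 0`. -/
def openSector (θ : ℝ) : Set ℂ := {w | w ≠ 0 ∧ |arg w| < θ}

variable {θ : ℝ} {w : ℂ}

theorem one_mem_openSector (hθ : 0 < θ) : (1 : ℂ) ∈ openSector θ := by
  simpa [openSector] using hθ

theorem mem_slitPlane_of_abs_arg_lt_pi (hw : w ≠ 0) (h : |arg w| < Real.pi) : w ∈ slitPlane :=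
  mem_slitPlane_iff_arg.2 ⟨fun hpi ↦ by simp [hpi, abs_of_pos Real.pi_pos] at h, hw⟩

theorem openSector_subset_slitPlane (hθ : θ ≤ Real.pi) : openSector θ ⊆ slitPlane :=
  fun _ hw ↦ mem_slitPlane_of_abs_arg_lt_pi hw.1 (hw.2.trans_le hθ)

theorem continuousAt_abs_arg (hw : w ≠ 0) : ContinuousAt (fun z ↦ |arg z|) w := by
  have hangle : (fun z ↦ InnerProductGeometry.angle z 1) =ᶠ[𝓝 w] fun z ↦ |arg z| := by
    filter_upwards [isOpen_ne.mem_nhds hw] with z hz using angle_one_right hz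
  refine ContinuousAt.congr ?_ hangle
  exact (InnerProductGeometry.continuousAt_angle (x := (w, (1 : ℂ))) hw one_ne_zero).comp
    (f := fun z : ℂ ↦ (z, (1 : ℂ))) (by fun_prop)

theorem isOpen_openSector (θ : ℝ) : IsOpen (openSector θ) := by
  refine isOpen_iff_mem_nhds.2 fun w hw ↦ ?_
  exact (eventually_ne_nhds hw.1).and ((continuousAt_abs_arg hw.1).eventually_lt_const hw.2)

theorem re_pos_of_mem_openSector (hθ : θ ≤ Real.pi / 2) (hw : w ∈ openSector θ) : 0 < w.re :=
  (abs_arg_lt_pi_div_two_iff.1 (hw.2.trans_le hθ)).resolve_right hw.1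

theorem abs_arg_le_of_mem_closure_openSector (h : w ∈ closure (openSector θ)) (hw : w ≠ 0) :
    |arg w| ≤ θ :=
  (continuousAt_abs_arg hw).continuousWithinAt.closure_le h continuousWithinAt_const
    fun _ hz ↦ hz.2.le

theorem re_cpow_pos {p : ℝ} (hp : 0 < p) (hθ : θ * p ≤ Real.pi / 2) (hw : w ∈ openSector θ) :
    0 < (w ^ (p : ℂ)).re := by
  have harg : |arg w * p| < Real.pi / 2 := by
    rw [abs_mul, abs_of_pos hp]
    exact (mul_lt_mul_of_pos_right hw.2 hp).trans_le hθ
  rw [cpow_ofReal_re]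
  have := norm_pos_iff.2 hw.1
  have := Real.cos_pos_of_mem_Ioo (abs_lt.1 harg)
  positivity

/-- The point `(ε i s) ^ α` at distance `s ^ α` from the apex on a side of the sector of half-angle
`π α / 2`; the sign `ε = ±1` selects the side. -/
noncomputable def sectorSidePoint (α ε s : ℝ) : ℂ :=
  (s ^ α : ℝ) * exp (ε * Real.pi * I * α / 2)

variable {α ε s : ℝ}

theorem exists_eq_sectorSidePoint (hα : 0 < α) (hw : w ≠ 0) (harg : |arg w| = Real.pi * α / 2) :
    ∃ s : ℝ, 0 < s ∧ ∃ ε : ℝ, (ε = 1 ∨ ε = -1) ∧ w = sectorSidePoint α ε s := by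
  obtain ⟨ε, hε, hεarg⟩ : ∃ ε : ℝ, (ε = 1 ∨ ε = -1) ∧ arg w = ε * (Real.pi * α / 2) := by
    rcases abs_choice (arg w) with h | h
    · exact ⟨1, .inl rfl, by linarith⟩
    · exact ⟨-1, .inr rfl, by linarith⟩
  refine ⟨‖w‖ ^ α⁻¹, by positivity, ε, hε, ?_⟩
  conv_lhs => rw [← norm_mul_exp_arg_mul_I w]
  rw [hεarg, sectorSidePoint, Real.rpow_inv_rpow (norm_nonneg w) hα.ne']
  push_cast
  ring_nf

theorem exp_sign_mul_pi_div_two_mul_I (hε : ε = 1 ∨ ε = -1) :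
    exp (ε * (Real.pi / 2 * I)) = ε * I := by
  rcases hε with rfl | rfl
  · simp [exp_pi_div_two_mul_I]
  · simp [exp_neg, exp_pi_div_two_mul_I]

theorem log_sectorSidePoint (hα₀ : 0 < α) (hα₂ : α < 2) (hs : 0 < s) (hε : ε = 1 ∨ ε = -1) :
    log (sectorSidePoint α ε s) = α * (Real.log s + ε * (Real.pi / 2 * I)) := by
  have hexp : sectorSidePoint α ε s = exp (α * (Real.log s + ε * (Real.pi / 2 * I))) := by
    rw [sectorSidePoint, Real.rpow_def_of_pos hs, ofReal_exp, ← exp_add]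
    push_cast
    ring_nf
  have him : (α * (Real.log s + ε * (Real.pi / 2 * I)) : ℂ).im = ε * (α * Real.pi / 2) := by
    simp only [im_ofReal_mul, add_im, ofReal_im, zero_add, div_ofNat_re, mul_I_im, ofReal_re]
    ring
  have hpi := Real.pi_pos
  rw [hexp, log_exp] <;> rw [him] <;> rcases hε with rfl | rfl <;> nlinarith

theorem sectorSidePoint_ne_zero (hs : 0 < s) : sectorSidePoint α ε s ≠ 0 :=
  mul_ne_zero (ofReal_ne_zero.2 (by positivity)) (exp_ne_zero _)

theorem sectorSidePoint_mem_slitPlane (hα₀ : 0 < α) (hα₂ : α < 2) (hs : 0 < s)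
    (hε : ε = 1 ∨ ε = -1) : sectorSidePoint α ε s ∈ slitPlane := by
  refine mem_slitPlane_of_abs_arg_lt_pi (sectorSidePoint_ne_zero hs) ?_
  rw [← log_im, log_sectorSidePoint hα₀ hα₂ hs hε]
  simp only [im_ofReal_mul, add_im, ofReal_im, zero_add, div_ofNat_re, mul_I_im, ofReal_re]
  have hpi := Real.pi_pos
  rw [abs_lt]
  rcases hε with rfl | rfl <;> constructor <;> nlinarith

theorem sectorSidePoint_cpow_inv (hα₀ : 0 < α) (hα₂ : α < 2) (hs : 0 < s)
    (hε : ε = 1 ∨ ε = -1) : sectorSidePoint α ε s ^ ((α⁻¹ : ℝ) : ℂ) = s * (ε * I) := by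
  rw [cpow_def_of_ne_zero (sectorSidePoint_ne_zero hs), log_sectorSidePoint hα₀ hα₂ hs hε,
    ofReal_inv, mul_comm, inv_mul_cancel_left₀ (by exact_mod_cast hα₀.ne'), exp_add,
    exp_sign_mul_pi_div_two_mul_I hε, ← ofReal_exp, Real.exp_log hs]

end Sector

section SectorBoundary

variable {q : ℂ → ℂ} {α : ℝ} {z₀ d : ℂ}

theorem hasDerivAt_cpow_const_zero {c : ℂ} (hc : 1 < c.re) :
    HasDerivAt (fun w : ℂ ↦ w ^ c) 0 0 := by
  have hre : 0 < (c - 1).re := by simpa using hc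
  have hc0 : c ≠ 0 := by
    rintro rfl
    norm_num at hc
  have hlim : Tendsto (fun w : ℂ ↦ w ^ (c - 1)) (𝓝[≠] 0) (𝓝 0) := by
    have hcont := (continuousAt_cpow_const_of_re_pos (z := 0) (.inl le_rfl) hre).tendsto
    rw [zero_cpow (fun h ↦ by simp [h] at hre)] at hcont
    exact hcont.mono_left nhdsWithin_le_nhds
  refine hasDerivAt_iff_tendsto_slope.2 (hlim.congr' ?_)
  filter_upwards [self_mem_nhdsWithin] with w hw
  rw [slope_def_field, zero_cpow hc0, sub_zero, sub_zero, cpow_sub _ _ hw, cpow_one]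

theorem mul_inv_pi_mul_div_two (hα : α ≠ 0) : Real.pi * α / 2 * α⁻¹ = Real.pi / 2 := by
  field_simp

theorem pi_mul_div_two_le_pi (hα : α ≤ 2) : Real.pi * α / 2 ≤ Real.pi := by
  have := Real.pi_pos
  nlinarith

/-- `q ^ (1 / α)` would have vanishing derivative at a point where `q` reaches the apex, whereas
its values lie in the right half-plane. -/
theorem ne_zero_of_mapsTo_openSector (hα₀ : 0 < α) (hα₁ : α < 1)
    (hq : DifferentiableOn ℂ q (ball 0 ‖z₀‖))
    (hmaps : MapsTo q (ball 0 ‖z₀‖) (openSector (Real.pi * α / 2)))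
    (hz₀ : z₀ ≠ 0) (hd : HasDerivAt q d z₀) : q z₀ ≠ 0 := by
  intro hzero
  have hinv : 1 < α⁻¹ := (one_lt_inv₀ hα₀).2 hα₁
  have hpow : HasDerivAt (fun z ↦ q z ^ ((α⁻¹ : ℝ) : ℂ)) (0 * d) z₀ :=
    HasDerivAt.comp_of_eq (h₂ := fun w ↦ w ^ ((α⁻¹ : ℝ) : ℂ)) z₀
      (hasDerivAt_cpow_const_zero (by rwa [ofReal_re])) hd hzero.symm
  have hpos : ∀ z ∈ ball (0 : ℂ) ‖z₀‖, 0 < (q z ^ ((α⁻¹ : ℝ) : ℂ)).re := fun z hz ↦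
    re_cpow_pos (by positivity) (mul_inv_pi_mul_div_two hα₀.ne').le (hmaps hz)
  have hz₀_zero : q z₀ ^ ((α⁻¹ : ℝ) : ℂ) = 0 := by
    rw [hzero, zero_cpow (by exact_mod_cast (inv_pos.2 hα₀).ne')]
  obtain ⟨k, hk, hformula⟩ := exists_mul_deriv_eq_of_re_pos
    (hq.cpow_const fun z hz ↦ openSector_subset_slitPlane (pi_mul_div_two_le_pi (by linarith))
      (hmaps hz)) hpos hz₀ hpow (by rw [hz₀_zero, zero_re])
  have hcenter : q 0 ^ ((α⁻¹ : ℝ) : ℂ) ≠ 0 := fun h ↦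
    (h ▸ hpos 0 (by simpa)).ne' zero_re
  rw [hz₀_zero, zero_sub, norm_neg, zero_mul, mul_zero, mul_zero, zero_eq_neg,
    mul_eq_zero] at hformula
  norm_cast at hformula
  have := norm_pos_iff.2 hcenter
  rcases hformula with h | h
  · linarith
  · exact (by positivity : _ ≠ (0 : ℝ)) h

theorem exists_mul_deriv_eq_of_eq_sectorSidePoint {ε s : ℝ} (hα₀ : 0 < α) (hα₂ : α < 2)
    (hq : DifferentiableOn ℂ q (ball 0 ‖z₀‖))
    (hmaps : MapsTo q (ball 0 ‖z₀‖) (openSector (Real.pi * α / 2))) (h0 : q 0 = 1)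
    (hz₀ : z₀ ≠ 0) (hd : HasDerivAt q d z₀) (hs : 0 < s) (hε : ε = 1 ∨ ε = -1)
    (hside : q z₀ = sectorSidePoint α ε s) :
    ∃ k : ℝ, 1 ≤ k ∧ z₀ * d = (k * (α * (s + s⁻¹)) / 2 : ℝ) * (ε * I) * q z₀ := by
  have hpow : q z₀ ^ ((α⁻¹ : ℝ) : ℂ) = s * (ε * I) :=
    hside ▸ sectorSidePoint_cpow_inv hα₀ hα₂ hs hε
  have hne : q z₀ ≠ 0 := hside ▸ sectorSidePoint_ne_zero hs
  obtain ⟨k, hk, hformula⟩ := exists_mul_deriv_eq_of_re_pos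
    (hq.cpow_const fun z hz ↦ openSector_subset_slitPlane (pi_mul_div_two_le_pi hα₂.le) (hmaps hz))
    (fun z hz ↦ re_cpow_pos (inv_pos.2 hα₀) (mul_inv_pi_mul_div_two hα₀.ne').le (hmaps hz)) hz₀
    (hd.cpow_const (hside ▸ sectorSidePoint_mem_slitPlane hα₀ hα₂ hs hε))
    (by simp only [hpow, re_ofReal_mul, mul_I_re, ofReal_im, neg_zero, mul_zero])
  refine ⟨k, hk, ?_⟩
  have hsign : (ε * I : ℂ) * (ε * I) = -1 := by rcases hε with rfl | rfl <;> simp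
  have hnorm : ‖(s * (ε * I) - 1 : ℂ)‖ ^ 2 = 1 + s ^ 2 := by
    rw [← normSq_eq_norm_sq, normSq_apply]
    rcases hε with rfl | rfl <;> simp <;> ring
  have hsC : (s : ℂ) ≠ 0 := by exact_mod_cast hs.ne'
  have hαC : (α : ℂ) ≠ 0 := by exact_mod_cast hα₀.ne'
  rw [cpow_sub _ _ hne, cpow_one] at hformula
  simp only [hpow, h0, one_cpow, one_re] at hformula
  rw [← ofReal_pow, hnorm] at hformula
  push_cast at hformula ⊢
  field_simp at hformula ⊢
  linear_combination (-(ε : ℂ) * I) * hformula + (2 * z₀ * d * s) * hsign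

theorem exists_mul_deriv_eq_of_mapsTo_openSector (hα₀ : 0 < α) (hα₁ : α < 1)
    (hq : DifferentiableOn ℂ q (ball 0 ‖z₀‖))
    (hmaps : MapsTo q (ball 0 ‖z₀‖) (openSector (Real.pi * α / 2))) (h0 : q 0 = 1)
    (hz₀ : z₀ ≠ 0) (hd : HasDerivAt q d z₀) (hnot : q z₀ ∉ openSector (Real.pi * α / 2)) :
    ∃ s : ℝ, 0 < s ∧ ∃ ε : ℝ, (ε = 1 ∨ ε = -1) ∧ ∃ k : ℝ, 1 ≤ k ∧
      q z₀ = sectorSidePoint α ε s ∧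
      z₀ * d = (k * (α * (s + s⁻¹)) / 2 : ℝ) * (ε * I) * q z₀ := by
  have hne : q z₀ ≠ 0 := ne_zero_of_mapsTo_openSector hα₀ hα₁ hq hmaps hz₀ hd
  have hclosure : q z₀ ∈ closure (openSector (Real.pi * α / 2)) :=
    hd.continuousAt.continuousWithinAt.mem_closure (by simp [closure_ball, hz₀]) hmaps
  have harg : |arg (q z₀)| = Real.pi * α / 2 :=
    (abs_arg_le_of_mem_closure_openSector hclosure hne).antisymm
      (not_lt.1 fun hlt ↦ hnot ⟨hne, hlt⟩)
  obtain ⟨s, hs, ε, hε, hside⟩ := exists_eq_sectorSidePoint hα₀ hne harg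
  obtain ⟨k, hk, hderiv⟩ := exists_mul_deriv_eq_of_eq_sectorSidePoint hα₀ (by linarith) hq hmaps h0
    hz₀ hd hs hε hside
  exact ⟨s, hs, ε, hε, k, hk, hside, hderiv⟩

end SectorBoundary

section StarlikeQuotient

/-- The quotient `z f'(z) / f(z)` of `f(z) = z F(z)`, with its removable value `1` at `0`. -/
noncomputable def starlikeQuotient (F : ℂ → ℂ) (z : ℂ) : ℂ :=
  1 + z * logDeriv F z

variable {F : ℂ → ℂ} {z z₀ : ℂ}

theorem starlikeQuotient_zero (F : ℂ → ℂ) : starlikeQuotient F 0 = 1 := by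
  rw [starlikeQuotient, zero_mul, add_zero]

theorem hasDerivAt_self_mul (hF : DifferentiableAt ℂ F z) (hne : F z ≠ 0) :
    HasDerivAt (fun z ↦ z * F z) (F z * starlikeQuotient F z) z := by
  convert! (hasDerivAt_id' z).fun_mul hF.hasDerivAt using 1
  rw [starlikeQuotient, logDeriv_apply]
  field_simp

theorem differentiableAt_starlikeQuotient (hF : AnalyticAt ℂ F z) (hne : F z ≠ 0) :
    DifferentiableAt ℂ (starlikeQuotient F) z :=
  (differentiableAt_id.mul (hF.deriv.differentiableAt.div hF.differentiableAt hne)).const_add 1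

theorem self_mul_deriv_starlikeQuotient (hF : AnalyticAt ℂ F z) (hne : F z ≠ 0) :
    z * deriv (starlikeQuotient F) z + (starlikeQuotient F z - 1) * (starlikeQuotient F z - 2) =
      z ^ 2 * deriv (deriv F) z / F z := by
  have hderiv : HasDerivAt (starlikeQuotient F) (1 * (deriv F z / F z) + z *
      ((deriv (deriv F) z * F z - deriv F z * deriv F z) / F z ^ 2)) z :=
    ((hasDerivAt_id' z).mul
      (hF.deriv.differentiableAt.hasDerivAt.div hF.differentiableAt.hasDerivAt hne)).const_add 1
  rw [hderiv.deriv, starlikeQuotient, logDeriv_apply]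
  field_simp
  ring

theorem hasDerivAt_norm_self_mul_sq_radial {t : ℝ} (hF : DifferentiableAt ℂ F (t * z₀))
    (hne : F (t * z₀) ≠ 0) :
    HasDerivAt (fun t : ℝ ↦ ‖t * z₀ * F (t * z₀)‖ ^ 2)
      (2 * (t * ‖z₀‖ ^ 2 * ‖F (t * z₀)‖ ^ 2 * (starlikeQuotient F (t * z₀)).re)) t := by
  have hray : HasDerivAt (fun t : ℝ ↦ (t * z₀ : ℂ)) (1 * z₀) t :=
    (HasDerivAt.ofReal_comp (hasDerivAt_id' t)).mul_const z₀
  have hinner : F (t * z₀) * starlikeQuotient F (t * z₀) * (1 * z₀) * conj (t * z₀ * F (t * z₀)) =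
      (t * ‖z₀‖ ^ 2 * ‖F (t * z₀)‖ ^ 2 : ℝ) * starlikeQuotient F (t * z₀) := by
    rw [map_mul, map_mul, conj_ofReal]
    push_cast
    rw [← mul_conj', ← mul_conj']
    ring
  convert! ((hasDerivAt_self_mul hF hne).comp t hray).norm_sq using 2
  rw [Function.comp_apply, Complex.inner, hinner, re_ofReal_mul]

theorem monotoneOn_norm_self_mul_sq_radial (hF : DiffContOnCl ℂ F (ball 0 ‖z₀‖))
    (hne : ∀ z ∈ ball (0 : ℂ) ‖z₀‖, F z ≠ 0)
    (hre : ∀ z ∈ ball (0 : ℂ) ‖z₀‖, 0 ≤ (starlikeQuotient F z).re) (hz₀ : z₀ ≠ 0) :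
    MonotoneOn (fun t : ℝ ↦ ‖t * z₀ * F (t * z₀)‖ ^ 2) (Icc 0 1) := by
  have hball : ∀ t ∈ Ioo (0 : ℝ) 1, (t * z₀ : ℂ) ∈ ball (0 : ℂ) ‖z₀‖ := fun t ht ↦ by
    rw [mem_ball_zero_iff, norm_mul, norm_real, Real.norm_of_nonneg ht.1.le]
    exact mul_lt_of_lt_one_left (norm_pos_iff.2 hz₀) ht.2
  have hclosedBall : MapsTo (fun t : ℝ ↦ (t * z₀ : ℂ)) (Icc 0 1) (closedBall 0 ‖z₀‖) :=
    fun t ht ↦ by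
      rw [mem_closedBall_zero_iff, norm_mul, norm_real, Real.norm_of_nonneg ht.1]
      exact mul_le_of_le_one_left (norm_nonneg _) ht.2
  have hray : ContinuousOn (fun t : ℝ ↦ (t * z₀ : ℂ)) (Icc 0 1) := by fun_prop
  have hderiv : ∀ t ∈ Ioo (0 : ℝ) 1, HasDerivAt (fun t : ℝ ↦ ‖t * z₀ * F (t * z₀)‖ ^ 2) _ t :=
    fun t ht ↦ hasDerivAt_norm_self_mul_sq_radial
      (hF.differentiableAt isOpen_ball (hball t ht)) (hne _ (hball t ht))
  refine monotoneOn_of_deriv_nonneg (convex_Icc 0 1)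
    ((hray.mul (hF.continuousOn_ball.comp hray hclosedBall)).norm.pow 2) ?_ ?_ <;>
  rw [interior_Icc]
  · exact fun t ht ↦ (hderiv t ht).differentiableAt.differentiableWithinAt
  · intro t ht
    rw [(hderiv t ht).deriv]
    have := hre _ (hball t ht)
    have := ht.1
    positivity

theorem ne_zero_of_re_starlikeQuotient_nonneg (hF : DiffContOnCl ℂ F (ball 0 ‖z₀‖))
    (hne : ∀ z ∈ ball (0 : ℂ) ‖z₀‖, F z ≠ 0)
    (hre : ∀ z ∈ ball (0 : ℂ) ‖z₀‖, 0 ≤ (starlikeQuotient F z).re) (hz₀ : z₀ ≠ 0) : F z₀ ≠ 0 := by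
  intro hzero
  have hhalf : ((1 / 2 : ℝ) * z₀ : ℂ) ∈ ball (0 : ℂ) ‖z₀‖ := by
    rw [mem_ball_zero_iff, norm_mul, norm_real, Real.norm_of_nonneg (by norm_num)]
    linarith [norm_pos_iff.2 hz₀]
  have hle := monotoneOn_norm_self_mul_sq_radial hF hne hre hz₀
    (show (1 / 2 : ℝ) ∈ Icc 0 1 by norm_num) (show (1 : ℝ) ∈ Icc 0 1 by norm_num) (by norm_num)
  simp only [ofReal_one, one_mul, hzero, mul_zero, norm_zero, ne_eq, OfNat.ofNat_ne_zero,
    not_false_eq_true, zero_pow] at hle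
  have hpos : 0 < ‖((1 / 2 : ℝ) * z₀ : ℂ) * F ((1 / 2 : ℝ) * z₀)‖ :=
    norm_pos_iff.2 (mul_ne_zero (mul_ne_zero (by norm_num) hz₀) (hne _ hhalf))
  exact (pow_pos hpos 2).not_ge hle

end StarlikeQuotient

section OpenDoor

theorem ball_subset_of_forall_ball_dist_subset {X : Type*} [PseudoMetricSpace X] [ProperSpace X]
    {s : Set X} {x : X} {r : ℝ} (hs : IsOpen s)
    (h : ∀ z ∈ ball x r, ball x (dist z x) ⊆ s → z ∈ s) : ball x r ⊆ s := by
  intro y hy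
  by_contra hys
  obtain ⟨z, hz, hmin⟩ := ((isCompact_closedBall x (dist y x)).diff hs).exists_isMinOn
    ⟨y, mem_closedBall.2 le_rfl, hys⟩ (continuous_id.dist continuous_const).continuousOn
  have hzy : dist z x ≤ dist y x := hz.1
  refine hz.2 (h z (hzy.trans_lt hy) fun w hw ↦ ?_)
  by_contra hws
  exact (mem_ball.1 hw).not_ge (hmin ⟨(mem_ball.1 hw).le.trans hz.1, hws⟩)

variable {F : ℂ → ℂ} {α r : ℝ}

theorem isOpen_setOf_starlikeQuotient_mem {U V : Set ℂ} (hU : IsOpen U) (hV : IsOpen V)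
    (hF : AnalyticOnNhd ℂ F U) :
    IsOpen {z | (z ∈ U ∧ F z ≠ 0) ∧ starlikeQuotient F z ∈ V} := by
  have hne : IsOpen {z | z ∈ U ∧ F z ≠ 0} :=
    hF.continuousOn.isOpen_inter_preimage hU isOpen_ne
  have hcont : ContinuousOn (starlikeQuotient F) {z | z ∈ U ∧ F z ≠ 0} := fun z hz ↦
    (differentiableAt_starlikeQuotient (hF z hz.1) hz.2).continuousAt.continuousWithinAt
  exact hcont.isOpen_inter_preimage hne hV

theorem starlikeQuotient_mem_openSector_of_forall_ne (hα₀ : 0 < α) (hα₁ : α < 1)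
    (hF : AnalyticOnNhd ℂ F (ball 0 r)) (hF0 : F 0 ≠ 0)
    (hside : ∀ z ∈ ball (0 : ℂ) r, F z ≠ 0 → ∀ s : ℝ, 0 < s → ∀ ε : ℝ, ε = 1 ∨ ε = -1 →
      ∀ k : ℝ, 1 ≤ k → starlikeQuotient F z = sectorSidePoint α ε s →
      z * deriv (starlikeQuotient F) z ≠
        (k * (α * (s + s⁻¹)) / 2 : ℝ) * (ε * I) * starlikeQuotient F z) :
    ∀ z ∈ ball (0 : ℂ) r, F z ≠ 0 ∧ starlikeQuotient F z ∈ openSector (Real.pi * α / 2) := by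
  set S : Set ℂ := {z | (z ∈ ball 0 r ∧ F z ≠ 0) ∧
    starlikeQuotient F z ∈ openSector (Real.pi * α / 2)}
  have hS : IsOpen S := isOpen_setOf_starlikeQuotient_mem isOpen_ball (isOpen_openSector _) hF
  suffices ball 0 r ⊆ S from fun z hz ↦ ⟨(this hz).1.2, (this hz).2⟩
  refine ball_subset_of_forall_ball_dist_subset hS fun z₀ hz₀r hsub ↦ ?_
  rw [dist_zero_right] at hsub
  have hπα : 0 < Real.pi * α / 2 := by positivity
  rcases eq_or_ne z₀ 0 with rfl | hz₀
  · exact ⟨⟨hz₀r, hF0⟩, starlikeQuotient_zero F ▸ one_mem_openSector hπα⟩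
  have hclosed : closedBall 0 ‖z₀‖ ⊆ ball (0 : ℂ) r :=
    closedBall_subset_ball (mem_ball_zero_iff.1 hz₀r)
  have hre : ∀ z ∈ ball (0 : ℂ) ‖z₀‖, 0 ≤ (starlikeQuotient F z).re := fun z hz ↦
    (re_pos_of_mem_openSector (by nlinarith [Real.pi_pos]) (hsub hz).2).le
  have hFz₀ : F z₀ ≠ 0 := ne_zero_of_re_starlikeQuotient_nonneg
    (hF.differentiableOn.diffContOnCl_ball hclosed) (fun z hz ↦ (hsub hz).1.2) hre hz₀
  refine ⟨⟨hz₀r, hFz₀⟩, ?_⟩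
  by_contra hnot
  have hdiff : ∀ z ∈ ball (0 : ℂ) r, F z ≠ 0 → DifferentiableAt ℂ (starlikeQuotient F) z :=
    fun z hz hne ↦ differentiableAt_starlikeQuotient (hF z hz) hne
  obtain ⟨s, hs, ε, hε, k, hk, hval, hderiv⟩ := exists_mul_deriv_eq_of_mapsTo_openSector hα₀ hα₁
    (fun z hz ↦ (hdiff z (hsub hz).1.1 (hsub hz).1.2).differentiableWithinAt)
    (fun z hz ↦ (hsub hz).2) (starlikeQuotient_zero F) hz₀ (hdiff z₀ hz₀r hFz₀).hasDerivAt hnot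
  exact hside z₀ hz₀r hFz₀ s hs ε hε k hk hval hderiv

end OpenDoor

section OrdinaryHypergeometric

section RCLike

variable {𝕂 : Type*} (𝔸 : Type*) [RCLike 𝕂] [NormedDivisionRing 𝔸] [NormedAlgebra 𝕂 𝔸] (a b c : 𝕂)

theorem one_le_radius_ordinaryHypergeometricSeries :
    1 ≤ (ordinaryHypergeometricSeries 𝔸 a b c).radius := by
  by_cases h : ∀ n : ℕ, (n : 𝕂) ≠ -a ∧ (n : 𝕂) ≠ -b ∧ (n : 𝕂) ≠ -c
  · exact (ordinaryHypergeometricSeries_radius_eq_one 𝔸 a b c h).ge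
  · simp only [not_forall, not_and_or, not_not] at h
    obtain ⟨n, ha | hb | hc⟩ := h
    · simp [← neg_eq_iff_eq_neg.2 ha, ordinaryHypergeometric_radius_top_of_neg_nat₁]
    · simp [← neg_eq_iff_eq_neg.2 hb, ordinaryHypergeometric_radius_top_of_neg_nat₂]
    · simp [← neg_eq_iff_eq_neg.2 hc, ordinaryHypergeometric_radius_top_of_neg_nat₃]

variable [CompleteSpace 𝔸]

theorem hasFPowerSeriesOnBall_ordinaryHypergeometric :
    HasFPowerSeriesOnBall (ordinaryHypergeometric a b c : 𝔸 → 𝔸)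
      (ordinaryHypergeometricSeries 𝔸 a b c) 0 1 := by
  have hradius := one_le_radius_ordinaryHypergeometricSeries 𝔸 a b c
  exact (FormalMultilinearSeries.hasFPowerSeriesOnBall _ (zero_lt_one.trans_le hradius)).mono
    zero_lt_one hradius

theorem analyticOnNhd_ordinaryHypergeometric :
    AnalyticOnNhd 𝕂 (ordinaryHypergeometric a b c : 𝔸 → 𝔸) (ball 0 1) := by
  have := (hasFPowerSeriesOnBall_ordinaryHypergeometric 𝔸 a b c).analyticOnNhd
  rwa [← ENNReal.coe_one, eball_coe, NNReal.coe_one] at this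

variable {a b c}

theorem iteratedDeriv_ordinaryHypergeometric_zero (n : ℕ) :
    iteratedDeriv n (ordinaryHypergeometric a b c : 𝕂 → 𝕂) 0
      = n ! * ordinaryHypergeometricCoefficient a b c n := by
  have hseries := (hasFPowerSeriesOnBall_ordinaryHypergeometric 𝕂 a b c).hasFPowerSeriesAt
  have htaylor :=
    (analyticOnNhd_ordinaryHypergeometric 𝕂 a b c 0 (by simp)).hasFPowerSeriesAt
  have := congrFun (FormalMultilinearSeries.ofScalars_series_injective 𝕂 𝕂
    (hseries.eq_formalMultilinearSeries htaylor)) n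
  rw [this, mul_div_cancel₀ _ (by exact_mod_cast n.factorial_ne_zero)]

theorem ordinaryHypergeometricCoefficient_succ {n : ℕ} (hc : c + n ≠ 0) :
    (c + n) * ((n + 1) * ordinaryHypergeometricCoefficient a b c (n + 1)) =
      (a + n) * (b + n) * ordinaryHypergeometricCoefficient a b c n := by
  have : (n + 1 : 𝕂) ≠ 0 := n.cast_add_one_ne_zero
  simp only [ordinaryHypergeometricCoefficient, ascPochhammer_succ_eval, Nat.factorial_succ,
    Nat.cast_mul, Nat.cast_add_one, mul_inv]
  field_simp

theorem iteratedDeriv_succ_ordinaryHypergeometric_zero {n : ℕ} (hc : c + n ≠ 0) :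
    (c + n) * iteratedDeriv (n + 1) (ordinaryHypergeometric a b c : 𝕂 → 𝕂) 0 =
      (a + n) * (b + n) * iteratedDeriv n (ordinaryHypergeometric a b c : 𝕂 → 𝕂) 0 := by
  rw [iteratedDeriv_ordinaryHypergeometric_zero, iteratedDeriv_ordinaryHypergeometric_zero,
    Nat.factorial_succ]
  push_cast
  linear_combination (n ! : 𝕂) * ordinaryHypergeometricCoefficient_succ (a := a) (b := b) hc

end RCLike

theorem hasSum_iteratedDeriv_add {F : ℂ → ℂ} {x z : ℂ} {r : ℝ}
    (hF : DifferentiableOn ℂ F (ball x r)) (hz : z ∈ ball x r) (m : ℕ) :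
    HasSum (fun n : ℕ ↦ iteratedDeriv (n + m) F x * ((z - x) ^ n / n !)) (iteratedDeriv m F z) := by
  have hderiv : DifferentiableOn ℂ (iteratedDeriv m F) (ball x r) := by
    rw [iteratedDeriv_eq_iterate]
    exact ((hF.analyticOnNhd isOpen_ball).iterated_deriv m).differentiableOn
  convert! hasSum_taylorSeries_on_ball hderiv hz using 2 with n
  simp only [iteratedDeriv_eq_iterate, Function.iterate_add_apply, smul_eq_mul]
  ring

theorem hasSum_natCast_mul_pow_div_factorial {D : ℕ → ℂ} {z s : ℂ}
    (h : HasSum (fun n : ℕ ↦ D (n + 1) * (z ^ n / n !)) s) :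
    HasSum (fun n : ℕ ↦ (n * D n) * (z ^ n / n !)) (z * s) := by
  rw [← hasSum_nat_add_iff' 1]
  simp only [Finset.range_one, Finset.sum_singleton, Nat.cast_zero, zero_mul, sub_zero]
  convert! h.mul_left z using 2 with n
  have hfactorial : (n ! : ℂ) ≠ 0 := by exact_mod_cast n.factorial_ne_zero
  have hsucc : (n : ℂ) + 1 ≠ 0 := n.cast_add_one_ne_zero
  rw [Nat.factorial_succ]
  push_cast
  field_simp
  ring

variable {a b c z : ℂ}

/-- The operator `z d/dz` multiplies the `n`-th Taylor coefficient by `n`, which turns the equation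
into the recurrence of the coefficients. -/
theorem ordinaryHypergeometric_ode (hc : ∀ n : ℕ, c + n ≠ 0) (hz : z ∈ ball (0 : ℂ) 1) :
    z * (1 - z) * deriv (deriv (ordinaryHypergeometric a b c : ℂ → ℂ)) z
      + (c - (a + b + 1) * z) * deriv (ordinaryHypergeometric a b c : ℂ → ℂ) z
      = a * b * ordinaryHypergeometric a b c z := by
  set F : ℂ → ℂ := ordinaryHypergeometric a b c
  set D : ℕ → ℂ := fun n ↦ iteratedDeriv n F 0
  have htaylor (m : ℕ) : HasSum (fun n ↦ D (n + m) * (z ^ n / n !)) (iteratedDeriv m F z) := by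
    simpa only [sub_zero] using hasSum_iteratedDeriv_add
      (analyticOnNhd_ordinaryHypergeometric ℂ a b c).differentiableOn hz m
  have hz_deriv : HasSum (fun n : ℕ ↦ n * D n * (z ^ n / n !)) (z * iteratedDeriv 1 F z) :=
    hasSum_natCast_mul_pow_div_factorial (htaylor 1)
  have hz_deriv2 : HasSum (fun n : ℕ ↦ n * D (n + 1) * (z ^ n / n !)) (z * iteratedDeriv 2 F z) :=
    hasSum_natCast_mul_pow_div_factorial (D := fun n ↦ D (n + 1)) (htaylor 2)
  have hz2_deriv2 : HasSum (fun n : ℕ ↦ n * ((n - 1) * D n) * (z ^ n / n !))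
      (z * (z * iteratedDeriv 2 F z)) :=
    hasSum_natCast_mul_pow_div_factorial (D := fun n ↦ (n - 1) * D n) (by simpa using hz_deriv2)
  have hsum := ((hz_deriv2.sub hz2_deriv2).add
    (((htaylor 1).mul_left c).sub (hz_deriv.mul_left (a + b + 1)))).sub
    ((htaylor 0).mul_left (a * b))
  have hzero := hsum.unique (hasSum_zero.congr_fun fun n ↦ by
    have hrec := iteratedDeriv_succ_ordinaryHypergeometric_zero (a := a) (b := b) (hc n)
    simp only [D, F, add_zero]
    linear_combination (z ^ n / n !) * hrec)
  rw [iteratedDeriv_succ, iteratedDeriv_one, iteratedDeriv_zero] at hzero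
  linear_combination hzero

theorem ordinaryHypergeometric_riccati (hc : ∀ n : ℕ, c + n ≠ 0) (hz : z ∈ ball (0 : ℂ) 1)
    (hne : ordinaryHypergeometric a b c z ≠ 0) :
    let q := starlikeQuotient (ordinaryHypergeometric a b c)
    (1 - z) * (z * deriv q z + (q z - 1) * (q z - 2)) + (c - (a + b + 1) * z) * (q z - 1) =
      a * b * z := by
  intro q
  rw [self_mul_deriv_starlikeQuotient (analyticOnNhd_ordinaryHypergeometric ℂ a b c z hz) hne]
  simp only [q, starlikeQuotient, logDeriv_apply]
  field_simp
  linear_combination z * ordinaryHypergeometric_ode (a := a) (b := b) hc hz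

theorem one_sub_ne_zero_of_mem_ball (hz : z ∈ ball (0 : ℂ) 1) : 1 - z ≠ 0 := by
  rintro h
  simp [← sub_eq_zero.1 h] at hz

theorem ordinaryHypergeometric_add_one_riccati (hc : ∀ n : ℕ, a + b + 1 + n ≠ 0)
    (hz : z ∈ ball (0 : ℂ) 1) (hne : ordinaryHypergeometric a b (a + b + 1) z ≠ 0) :
    let q := starlikeQuotient (ordinaryHypergeometric a b (a + b + 1))
    z * deriv q z + (q z - 1) * (q z + a + b - 1) = a * b * (z / (1 - z)) := by
  intro q
  have hsub := one_sub_ne_zero_of_mem_ball hz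
  refine mul_left_cancel₀ hsub ?_
  field_simp
  linear_combination ordinaryHypergeometric_riccati hc hz hne

end OrdinaryHypergeometric

section BoundaryInequality

theorem neg_half_lt_re_div_one_sub {z : ℂ} (hz : z ∈ ball (0 : ℂ) 1) :
    -(1 / 2) < (z / (1 - z)).re := by
  have hnorm : ‖z‖ < 1 := mem_ball_zero_iff.1 hz
  have hsub := normSq_pos.2 (one_sub_ne_zero_of_mem_ball hz)
  have hsq : normSq z < 1 := by
    rw [normSq_eq_norm_sq]
    exact pow_lt_one₀ (norm_nonneg z) hnorm two_ne_zero
  rw [div_re, ← add_div, lt_div_iff₀ hsub]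
  simp only [normSq_apply, sub_re, sub_im, one_re, one_im] at hsq ⊢
  linarith

theorem smul_add_ne_mul_of_re_le {A d Q w : ℂ} {k : ℝ} (hA : A ≠ 0) (hk : 1 ≤ k)
    (hw : -(1 / 2) < w.re) (hd : (conj A * d).re ≤ 0)
    (hQ : (conj A * (d + Q)).re ≤ -(‖A‖ ^ 2 / 2)) : k • d + Q ≠ A * w := by
  intro heq
  have hleft : (conj A * (k • d + Q)).re =
      (k - 1) * (conj A * d).re + (conj A * (d + Q)).re := by
    simp only [mul_add, mul_smul_comm, add_re, smul_re, smul_eq_mul]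
    ring
  have hright : (conj A * (A * w)).re = ‖A‖ ^ 2 * w.re := by
    rw [← mul_assoc, conj_mul', ← ofReal_pow, re_ofReal_mul]
  have hnorm : 0 < ‖A‖ ^ 2 := by positivity
  rw [heq, hright] at hleft
  nlinarith [mul_nonpos_of_nonneg_of_nonpos (sub_nonneg.2 hk) hd]

theorem re_exp_mul_I_mul (t : ℝ) (w : ℂ) :
    (exp (t * I) * w).re = ‖w‖ * Real.cos (t + arg w) := by
  conv_lhs => rw [← norm_mul_exp_arg_mul_I w]
  rw [mul_left_comm, ← exp_add, ← add_mul, ← ofReal_add, re_ofReal_mul, exp_ofReal_mul_I_re]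

variable {α ε s : ℝ}

theorem re_exp_mul_nonneg_of_abs_arg_le {w : ℂ} (hα : α ≤ 1) (hε : ε = 1 ∨ ε = -1)
    (hw : |arg w| ≤ Real.pi * α / 2) :
    0 ≤ (exp (ε * Real.pi * I * (1 - α) / 2) * w).re := by
  have hexp : (ε * Real.pi * I * (1 - α) / 2 : ℂ) = (ε * (Real.pi * (1 - α) / 2) : ℝ) * I := by
    push_cast
    ring
  rw [hexp, re_exp_mul_I_mul]
  have hpi : 0 ≤ Real.pi * (1 - α) := mul_nonneg Real.pi_pos.le (sub_nonneg.2 hα)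
  refine mul_nonneg (norm_nonneg w) (Real.cos_nonneg_of_mem_Icc ?_)
  rw [abs_le] at hw
  rcases hε with rfl | rfl <;> constructor <;> linarith

theorem conj_sectorSidePoint :
    conj (sectorSidePoint α ε s) = (s ^ α : ℝ) * exp (-(ε * Real.pi * I * α / 2)) := by
  rw [sectorSidePoint, map_mul, conj_ofReal, ← exp_conj]
  simp only [map_div₀, map_mul, conj_ofReal, conj_I, map_ofNat]
  ring_nf

theorem conj_sectorSidePoint_sq (hs : 0 ≤ s) :
    conj (sectorSidePoint α ε s) ^ 2 = (s ^ (2 * α) : ℝ) * exp (-(ε * Real.pi * I * α)) := by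
  rw [conj_sectorSidePoint, mul_pow, ← ofReal_pow, ← Real.rpow_mul_natCast hs, ← exp_nat_mul]
  push_cast
  ring_nf

theorem sign_mul_I_mul_conj_sectorSidePoint (hε : ε = 1 ∨ ε = -1) :
    ε * I * conj (sectorSidePoint α ε s) =
      (s ^ α : ℝ) * exp (ε * Real.pi * I * (1 - α) / 2) := by
  have hexp : (ε * Real.pi * I * (1 - α) / 2 : ℂ) =
      ε * (Real.pi / 2 * I) + -(ε * Real.pi * I * α / 2) := by ring
  rw [hexp, exp_add, exp_sign_mul_pi_div_two_mul_I hε, conj_sectorSidePoint]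
  ring

theorem re_conj_mul_sign_mul_I_mul_sectorSidePoint (hε : ε = 1 ∨ ε = -1) (A : ℂ) :
    (conj A * ((ε * I) * sectorSidePoint α ε s)).re =
      -(s ^ α * (exp (ε * Real.pi * I * (1 - α) / 2) * A).re) := by
  have hconj : conj (conj A * ((ε * I) * sectorSidePoint α ε s)) =
      -((s ^ α : ℝ) * (exp (ε * Real.pi * I * (1 - α) / 2) * A)) := by
    simp only [map_mul, conj_conj, conj_ofReal, conj_I]
    linear_combination -A * sign_mul_I_mul_conj_sectorSidePoint (α := α) (s := s) hε
  rw [← conj_re, hconj, neg_re, re_ofReal_mul]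

theorem re_conj_mul_riccati_sectorSidePoint (hs : 0 ≤ s) (a b : ℂ) :
    (conj (a * b) * ((sectorSidePoint α ε s - 1) * (sectorSidePoint α ε s + a + b - 1))).re =
      s ^ (2 * α) * (exp (-(ε * Real.pi * I * α)) * (a * b)).re
        + s ^ α * (exp (-(ε * Real.pi * I * α / 2)) * (a * b) * (conj a + conj b - 2)).re
        - (a * b * (conj a + conj b - 1)).re := by
  have hconj : conj (conj (a * b) *
      ((sectorSidePoint α ε s - 1) * (sectorSidePoint α ε s + a + b - 1))) =
      (s ^ (2 * α) : ℝ) * (exp (-(ε * Real.pi * I * α)) * (a * b))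
        + (s ^ α : ℝ) * (exp (-(ε * Real.pi * I * α / 2)) * (a * b) * (conj a + conj b - 2))
        - a * b * (conj a + conj b - 1) := by
    simp only [map_mul, map_add, map_sub, map_one, conj_conj]
    linear_combination a * b * conj_sectorSidePoint_sq (α := α) (ε := ε) hs
      + a * b * (conj a + conj b - 2) * conj_sectorSidePoint (α := α) (ε := ε) (s := s)
  rw [← conj_re, hconj, sub_re, add_re, re_ofReal_mul, re_ofReal_mul]

theorem riccati_sectorSidePoint_ne {a b w : ℂ} {k : ℝ} (hα₀ : 0 ≤ α) (hα₁ : α ≤ 1) (hs : 0 ≤ s)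
    (hε : ε = 1 ∨ ε = -1) (hk : 1 ≤ k) (hw : -(1 / 2) < w.re) (hab : a * b ≠ 0)
    (harg : |arg (a * b)| ≤ Real.pi * α / 2)
    (hineq : 2 * s ^ (2 * α) * (exp (-(ε * Real.pi * I * α)) * (a * b)).re
        + 2 * s ^ α * (exp (-(ε * Real.pi * I * α / 2)) * (a * b) * (conj a + conj b - 2)).re
        + ‖a * b‖ ^ 2 - 2 * (a * b * (conj a + conj b - 1)).re
      ≤ α * (s + s⁻¹) * s ^ α * (exp (ε * Real.pi * I * (1 - α) / 2) * (a * b)).re) :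
    (k * (α * (s + s⁻¹)) / 2 : ℝ) * (ε * I) * sectorSidePoint α ε s
      + (sectorSidePoint α ε s - 1) * (sectorSidePoint α ε s + a + b - 1) ≠ a * b * w := by
  set d : ℂ := (α * (s + s⁻¹) / 2) • ((ε * I) * sectorSidePoint α ε s)
  have hd : (k * (α * (s + s⁻¹)) / 2 : ℝ) * (ε * I) * sectorSidePoint α ε s = k • d := by
    simp only [d, real_smul]
    push_cast
    ring
  have hre_d : (conj (a * b) * d).re = -(α * (s + s⁻¹) * s ^ α *
      (exp (ε * Real.pi * I * (1 - α) / 2) * (a * b)).re / 2) := by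
    rw [mul_smul_comm, smul_re, re_conj_mul_sign_mul_I_mul_sectorSidePoint hε, smul_eq_mul]
    ring
  have hre_nonneg := re_exp_mul_nonneg_of_abs_arg_le hα₁ hε harg
  rw [hd]
  refine smul_add_ne_mul_of_re_le hab hk hw ?_ ?_
  · rw [hre_d]
    exact neg_nonpos.2 (by positivity)
  · rw [mul_add, add_re, hre_d, re_conj_mul_riccati_sectorSidePoint hs]
    linarith

end BoundaryInequality

theorem isStronglyStarlikeOfOrder_self_mul {α : ℝ} {F : ℂ → ℂ}
    (hF : AnalyticOnNhd ℂ F (ball 0 1)) (hF0 : F 0 = 1)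
    (hsector : ∀ z ∈ ball (0 : ℂ) 1,
      F z ≠ 0 ∧ starlikeQuotient F z ∈ openSector (Real.pi * α / 2)) :
    IsStronglyStarlikeOfOrder α fun z ↦ z * F z := by
  have hderiv : ∀ z ∈ ball (0 : ℂ) 1, deriv (fun z ↦ z * F z) z = F z * starlikeQuotient F z :=
    fun z hz ↦ (hasDerivAt_self_mul (hF z hz).differentiableAt (hsector z hz).1).deriv
  refine ⟨analyticOnNhd_id.mul hF, zero_mul _, ?_, ?_, ?_, ?_⟩
  · rw [hderiv 0 (by simp), starlikeQuotient_zero, hF0, one_mul]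
  · exact fun z hz hz0 ↦ mul_ne_zero hz0 (hsector z hz).1
  · intro z hz _
    rw [hderiv z hz]
    exact mul_ne_zero (hsector z hz).1 (hsector z hz).2.1
  · intro z hz hz0
    rw [hderiv z hz, ← mul_assoc, mul_div_cancel_left₀ _ (mul_ne_zero hz0 (hsector z hz).1)]
    exact (hsector z hz).2.2

theorem mainTheorem8 (α : ℝ) (hα0 : 0 < α) (hα1 : α < 1) (a b : ℂ)
    (hc : ∀ n : ℕ, a + b ≠ -((n : ℂ) + 1))
    (hab : a * b ≠ 0)
    (harg : |Complex.arg (a * b)| < Real.pi * α / 2)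
    (hineq : ∀ s : ℝ, 0 < s → ∀ ε : ℝ, ε = 1 ∨ ε = -1 →
      2 * s ^ (2 * α) * (Complex.exp (-(ε * Real.pi * Complex.I * α)) * (a * b)).re
        + 2 * s ^ α *
          (Complex.exp (-(ε * Real.pi * Complex.I * α / 2)) * (a * b) *
            (starRingEnd ℂ a + starRingEnd ℂ b - 2)).re
        + ‖a * b‖ ^ 2 - 2 * (a * b * (starRingEnd ℂ a + starRingEnd ℂ b - 1)).re
      ≤ α * (s + s⁻¹) * s ^ α *
          (Complex.exp (ε * Real.pi * Complex.I * (1 - α) / 2) * (a * b)).re) :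
    IsStronglyStarlikeOfOrder α (shiftedHypergeometric a b (a + b + 1)) := by
  have hF := analyticOnNhd_ordinaryHypergeometric ℂ a b (a + b + 1)
  have hF0 : ordinaryHypergeometric a b (a + b + 1) (0 : ℂ) = 1 := ordinaryHypergeometric_zero ..
  refine isStronglyStarlikeOfOrder_self_mul hF hF0
    (starlikeQuotient_mem_openSector_of_forall_ne hα0 hα1 hF (by simp [hF0]) ?_)
  intro z hz hne s hs ε hε k hk hq hjack
  have hriccati := ordinaryHypergeometric_add_one_riccati
    (fun n h ↦ hc n (by linear_combination h)) hz hne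
  simp only [hjack, hq] at hriccati
  exact riccati_sectorSidePoint_ne hα0.le hα1.le hs.le hε hk (neg_half_lt_re_div_one_sub hz) hab
    harg.le (hineq s hs ε hε) hriccati
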